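/- Let $\mathfrak U\subsetneq\mathfrak V$ be Grothendieck universes, with $\mathbb Z\in\mathfrak U$. A set is called $\mathfrak U$-small if it is in bijection with an element of $\mathfrak U$, and a category is called a $\mathfrak U$-category if all its sets $\operatorname{Hom}(X,Y)$ are $\mathfrak U$-small. Let $I\in\mathfrak V$ be a set that is not $\mathfrak U$-small, let $\Gamma$ be the quiver with pairwise distinct vertices $x$, $z$, $y_i$ ($i\in I$) and arrows $\sigma_i\colon y_i\to x$, $\tau_i\colon y_i\to z$ ($i\in I$), let $\mathcal C$ be its path category (objects: the vertices; morphisms: the paths, including trivial ones), let $\Sigma=\{\sigma_i\mid i\in I\}$, and let $q\colon\mathcal C\to\mathcal C[\Sigma^{-1}]$ be the localisation, that is, the universal functor inverting all $\sigma_i$. For a category $\mathcal D$ let $\operatorname{add}(\mathcal D)$ be its additive hull: formal finite direct sums of objects of the $\mathbb Z$-linearisation $\mathbb Z\mathcal D$, with matrices as morphisms. For an additive category $\mathcal B$ let $\operatorname{mod}(\mathcal B)$ be the category whose objects are the morphisms $X_1\to X_0$ of $\mathcal B$ (as formal cokernels) and whose morphisms are the commutative squares, modulo those whose component $X_0\to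 Y_0$ factors through $Y_1\to Y_0$; and let $\operatorname{Ab}(\mathcal B)=\operatorname{mod}(\operatorname{mod}(\mathcal B)^{\mathrm{op}})^{\mathrm{op}}$ be its abelian hull. These constructions are functorial, and there is a canonical functor $\mathcal D\to\operatorname{Ab}(\operatorname{add}(\mathcal D))$. For a Serre subcategory $\mathcal S$ of an abelian category $\mathcal A$, the quotient $\mathcal A/\mathcal S$ is the localisation of $\mathcal A$ with respect to all morphisms whose kernel and cokernel lie in $\mathcal S$. Then: 1. $\operatorname{Ab}(\operatorname{add}(\mathcal C))$ is an abelian category and a $\mathfrak U$-category. 2. Let $\mathcal S\subseteq\operatorname{Ab}(\operatorname{add}(\mathcal C))$ be the Serre subcategory generated by (that is, the smallest one containing) the kernels and cokernels of the images of the morphisms $\sigma_i$ ($i\in I$). The functor $\operatorname{Ab}(\operatorname{add}(\mathcal C))\to\operatorname{Ab}(\operatorname{add}(\mathcal C[\Sigma^{-1}]))$ induced by $q$ induces an equivalence $$\operatorname{Ab}(\operatorname{add}(\mathcal C))/\mathcal S\xrightarrow{\ \sim\ }\operatorname{Ab}(\operatorname{add}(\mathcal C[\Sigma^{-1}])),$$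 that is, there is an equivalence whose composite with the quotient functor is isomorphic to the functor induced by $q$. 3. The map $I\to\operatorname{Hom}_{\mathcal C[\Sigma^{-1}]}(x,z)$, $i\mapsto\tau_i\sigma_i^{-1}$, is a bijection. 4. None of the categories $\mathcal C[\Sigma^{-1}]$, $\operatorname{Ab}(\operatorname{add}(\mathcal C[\Sigma^{-1}]))$ and $\operatorname{Ab}(\operatorname{add}(\mathcal C))/\mathcal S$ is a $\mathfrak U$-category. -/

import Mathlib

open CategoryTheory CategoryTheory.Limits CategoryTheory.Preadditive

universe w u v

noncomputable section

/-! ### The additive hull -/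

/-- The additive hull `add(C)`: formal finite direct sums of objects of the
`ℤ`-linearisation `ℤC`, with matrices of morphisms of `ℤC` as morphisms. -/
abbrev AddHull (C : Type u) [Category.{w} C] := Mat_ (Free ℤ C)

/-- The canonical functor `C ⥤ add(C)`. -/
abbrev addHullEmbedding (C : Type u) [Category.{w} C] : C ⥤ AddHull C :=
  Free.embedding ℤ C ⋙ Mat_.embedding (Free ℤ C)

/-- The additive functor `add(C) ⥤ add(D)` induced by a functor `C ⥤ D`. -/
abbrev addHullMap {C D : Type u} [Category.{w} C] [Category.{w} D] (F : C ⥤ D) :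
    AddHull C ⥤ AddHull D :=
  (Free.lift ℤ (F ⋙ Free.embedding ℤ D)).mapMat_

instance {C D : Type u} [Category.{w} C] [Category.{w} D] (F : C ⥤ D) :
    (addHullMap F).Additive where
  map_add {M N f g} := by
    ext i j
    exact Functor.map_add (Free.lift ℤ (F ⋙ Free.embedding ℤ D)) (f := f i j) (g := g i j)

instance (C : Type u) [Category.{w} C] : HasZeroObject (AddHull C) :=
  hasZeroObject_of_hasFiniteBiproducts _

/-! ### The completion `mod(C)` under formal cokernels

For an additive category `C`, Mathlib's `RightFreyd C` is `mod(C)`: an object is a morphism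
`X₁ ⟶ X₀` of `C` (standing for its formal cokernel) and a morphism is a commutative square,
two squares being identified when their difference on `X₀ ⟶ Y₀` factors through `Y₁ ⟶ Y₀`. -/

/-- The functor `mod(C) ⥤ mod(D)` induced by an additive functor `F : C ⥤ D`, sending the formal
cokernel of `f` to the formal cokernel of `F.map f`. -/
def rightFreydMap {C D : Type*} [Category* C] [Category* D] [Preadditive C] [Preadditive D]
    (F : C ⥤ D) [F.Additive] : RightFreyd C ⥤ RightFreyd D :=
  CategoryTheory.Quotient.lift _ (F.mapArrow ⋙ RightFreyd.quotient D) (by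
    rintro X Y f g ⟨h⟩
    refine RightFreyd.eq_of_rightHomotopy _ _ ⟨F.map h.hom, ?_⟩
    exact (F.map_sub (f := f.right) (g := g.right)).symm.trans
      ((congrArg F.map h.comm).trans (F.map_comp _ _)))

instance {C D : Type*} [Category* C] [Category* D] [Preadditive C] [Preadditive D]
    (F : C ⥤ D) [F.Additive] : (rightFreydMap F).Additive where
  map_add {X Y f g} := by
    obtain ⟨f, rfl⟩ := (RightFreyd.quotient C).map_surjective f
    obtain ⟨g, rfl⟩ := (RightFreyd.quotient C).map_surjective g
    have h : F.mapArrow.map (f + g) = F.mapArrow.map f + F.mapArrow.map g := by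
      ext
      · exact F.map_add
      · exact F.map_add
    exact (congrArg (RightFreyd.quotient D).map h).trans
      ((RightFreyd.quotient D).map_add (f := F.mapArrow.map f) (g := F.mapArrow.map g))

instance (C : Type u) [Category.{w} C] [Preadditive C] [HasZeroObject C] :
    HasZeroObject (RightFreyd C) :=
  ⟨⟨_, (RightFreyd.functor C).map_isZero (isZero_zero C)⟩⟩

/-! ### The abelian hull -/

/-- The abelian hull `Ab(C) = mod(mod(C)ᵒᵖ)ᵒᵖ` of an additive category `C`. -/
abbrev AbHull (C : Type u) [Category.{w} C] [Preadditive C] :=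
  (RightFreyd (RightFreyd C)ᵒᵖ)ᵒᵖ

/-- The canonical functor `C ⥤ Ab(C)`. -/
abbrev abHullEmbedding (C : Type u) [Category.{w} C] [Preadditive C] [HasZeroObject C] :
    C ⥤ AbHull C :=
  RightFreyd.functor C ⋙ (RightFreyd.functor (RightFreyd C)ᵒᵖ).rightOp

/-- The functor `Ab(C) ⥤ Ab(D)` induced by an additive functor `C ⥤ D`. -/
abbrev abHullMap {C D : Type u} [Category.{w} C] [Category.{w} D] [Preadditive C] [Preadditive D]
    (F : C ⥤ D) [F.Additive] : AbHull C ⥤ AbHull D :=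
  (rightFreydMap (rightFreydMap F).op).op

/-- The canonical functor `C ⥤ Ab(add(C))` for an arbitrary category `C`. -/
abbrev toAbAdd (C : Type u) [Category.{w} C] : C ⥤ AbHull (AddHull C) :=
  addHullEmbedding C ⋙ abHullEmbedding (AddHull C)

/-- The functor `Ab(add(C)) ⥤ Ab(add(D))` induced by a functor `C ⥤ D`. -/
abbrev abAddMap {C D : Type u} [Category.{w} C] [Category.{w} D] (F : C ⥤ D) :
    AbHull (AddHull C) ⥤ AbHull (AddHull D) :=
  abHullMap (addHullMap F)

/-! ### Serre subcategories generated by objects -/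

section Serre

variable {A : Type u} [Category.{w} A] [Abelian A]

/-- The Serre subcategory of an abelian category generated by a class `P` of objects:
the smallest one containing `P`. -/
def serreGenerated (P : ObjectProperty A) : ObjectProperty A :=
  fun X => ∀ S : ObjectProperty A, S.IsSerreClass → P ≤ S → S X

instance (P : ObjectProperty A) : (serreGenerated P).IsSerreClass where
  exists_zero := by
    obtain ⟨Z, hZ⟩ := HasZeroObject.zero (C := A)
    exact ⟨Z, hZ, fun S _ _ => S.prop_of_isZero hZ⟩
  prop_of_mono f _ hY := fun S hS hP => S.prop_of_mono f (hY S hS hP)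
  prop_of_epi f _ hX := fun S hS hP => S.prop_of_epi f (hX S hS hP)
  prop_X₂_of_shortExact hT h₁ h₃ := fun S hS hP =>
    S.prop_X₂_of_shortExact hT (h₁ S hS hP) (h₃ S hS hP)

/-- The kernels and cokernels in `A` of the images under `F` of the morphisms in `W`. -/
inductive KernelsCokernels {C : Type v} [Category* C] (F : C ⥤ A) (W : MorphismProperty C) :
    ObjectProperty A
  | kernel {X Y : C} (f : X ⟶ Y) (hf : W f) : KernelsCokernels F W (kernel (F.map f))
  | cokernel {X Y : C} (f : X ⟶ Y) (hf : W f) : KernelsCokernels F W (cokernel (F.map f))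

end Serre

/-! ### The quiver -/

/-- The vertices `x`, `z` and `y i` (`i ∈ I`). -/
inductive SpanVertex (I : Type v) : Type v
  | x : SpanVertex I
  | z : SpanVertex I
  | y (i : I) : SpanVertex I

/-- The arrows `σ i : y i ⟶ x` and `τ i : y i ⟶ z` (`i ∈ I`). -/
inductive SpanArrow (I : Type v) : SpanVertex I → SpanVertex I → Type v
  | σ (i : I) : SpanArrow I (.y i) .x
  | τ (i : I) : SpanArrow I (.y i) .z

/-- The quiver `x ⟵ y i ⟶ z` (`i ∈ I`). -/
instance (I : Type v) : Quiver.{v} (SpanVertex I) := ⟨SpanArrow I⟩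

namespace SpanPaths

variable (I : Type v)

/-- The vertex `x` as an object of the path category. -/
abbrev x : Paths (SpanVertex I) := (Paths.of (SpanVertex I)).obj .x
/-- The vertex `z` as an object of the path category. -/
abbrev z : Paths (SpanVertex I) := (Paths.of (SpanVertex I)).obj .z
variable {I}
/-- The vertex `y i` as an object of the path category. -/
abbrev y (i : I) : Paths (SpanVertex I) := (Paths.of (SpanVertex I)).obj (.y i)

/-- The arrow `σ i` as a morphism of the path category. -/
abbrev σ (i : I) : y i ⟶ x I := (Paths.of (SpanVertex I)).map (SpanArrow.σ i)
/-- The arrow `τ i` as a morphism of the path category. -/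
abbrev τ (i : I) : y i ⟶ z I := (Paths.of (SpanVertex I)).map (SpanArrow.τ i)

variable (I)

/-- The class `Σ = {σ i | i ∈ I}` of morphisms of the path category. -/
abbrev Sig : MorphismProperty (Paths (SpanVertex I)) := MorphismProperty.ofHoms (σ (I := I))

end SpanPaths

end

-- Everything except the size count is formal and holds for an arbitrary class `W` of morphisms. The
-- hull `Ab(add(C))` is universal: a functor from `C` to an abelian category `A` extends to an exact
-- functor on `Ab(add(C))` (`abAddLift`), uniquely up to isomorphism
-- (`nonempty_iso_of_toAbAdd_comp_iso`). An exact functor inverts the images of `W` exactly when it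
-- annihilates their kernels and cokernels, hence the Serre subcategory these generate. So exact
-- functors out of the Serre quotient, and exact functors out of the hull of the localisation, both
-- amount to functors on `C` inverting `W`. Comparing the two universal properties gives mutually
-- inverse functors (`exists_serreQuotient_equivalence`).
--
-- The universal property rests on `mod(V)`. It always has cokernels, and it is abelian as soon as
-- `V` has pullbacks. Since `mod(B)` has finite colimits, its opposite has pullbacks, so applying
-- `mod` a second time gives an abelian category. An additive functor to an abelian category is
-- extended by applying it to presentations and taking actual cokernels. This extension is right
-- exact, and it is left exact when the given functor preserves finite limits, which is the case at
-- the second step.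
--
-- For the size statements, the path category is thin, so all hom sets of its hull are countable.
-- After inverting the `σ i`, every morphism from `x` to `z` is some `τ i` after the inverse of `σ
-- i` (a normal form argument), and a functor to the free group on `I` separates these. The
-- canonical functor to the hull is faithful, and the equivalence carries the large hom set over to
-- the Serre quotient.

universe w' u'

/-! ### Kernels, cokernels and abelianness of `mod(V)`. -/

namespace CategoryTheory.Preadditive.RightFreyd

section Kernels

variable {V : Type*} [Category* V] [Preadditive V]

/-- Maps to zero in the right Freyd category are those whose target component factors. -/
lemma quotient_map_eq_zero_iff_exists {u v : Arrow V} (f : u ⟶ v) :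
    (quotient V).map f = 0 ↔ ∃ h : u.right ⟶ v.left, f.right = h ≫ v.hom := by
  rw [quotient_map_eq_zero_iff]
  constructor
  · rintro ⟨h⟩
    exact ⟨h.hom, by simpa using h.comm⟩
  · rintro ⟨h, hh⟩
    exact ⟨⟨h, by simpa using hh⟩⟩

lemma quotient_map_eq_iff_exists {u v : Arrow V} (f g : u ⟶ v) :
    (quotient V).map f = (quotient V).map g ↔
      ∃ h : u.right ⟶ v.left, f.right - g.right = h ≫ v.hom := by
  rw [quotient_map_eq_iff]
  exact ⟨fun ⟨h⟩ => ⟨h.hom, h.comm⟩, fun ⟨h, hh⟩ => ⟨⟨h, hh⟩⟩⟩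

lemma obj_surjective (X : RightFreyd V) : ∃ u : Arrow V, (quotient V).obj u = X :=
  ⟨X.as, rfl⟩

end Kernels

end CategoryTheory.Preadditive.RightFreyd

/-- A commutative square with the existence part of the universal property of a pullback. -/
structure IsWeakPullback {V : Type*} [Category* V] {P X Y Z : V}
    (fst : P ⟶ X) (snd : P ⟶ Y) (f : X ⟶ Z) (g : Y ⟶ Z) : Prop where
  w : fst ≫ f = snd ≫ g
  exists_lift {W : V} (a : W ⟶ X) (b : W ⟶ Y) (h : a ≫ f = b ≫ g) :
    ∃ l : W ⟶ P, l ≫ fst = a ∧ l ≫ snd = b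

lemma CategoryTheory.IsPullback.isWeakPullback {V : Type*} [Category* V] {P X Y Z : V}
    {fst : P ⟶ X} {snd : P ⟶ Y} {f : X ⟶ Z} {g : Y ⟶ Z} (h : IsPullback fst snd f g) :
    IsWeakPullback fst snd f g where
  w := h.w
  exists_lift a b hab := ⟨h.lift a b hab, by simp, by simp⟩

lemma exists_isWeakPullback {V : Type*} [Category* V] [HasPullbacks V] {X Y Z : V}
    (f : X ⟶ Z) (g : Y ⟶ Z) :
    ∃ (P : V) (a : P ⟶ X) (b : P ⟶ Y), IsWeakPullback a b f g :=
  ⟨_, _, _, (IsPullback.of_hasPullback f g).isWeakPullback⟩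

/-- A cospan with the existence part of the universal property of a binary coproduct. -/
def IsWeakCoproduct {V : Type*} [Category* V] {X Y N : V} (inl : X ⟶ N) (inr : Y ⟶ N) : Prop :=
  ∀ ⦃W : V⦄ (a : X ⟶ W) (b : Y ⟶ W), ∃ d : N ⟶ W, inl ≫ d = a ∧ inr ≫ d = b

namespace CategoryTheory.Preadditive.RightFreyd

section

variable {V : Type*} [Category* V] [Preadditive V]

section Kernel

variable {u v : Arrow V} (f : u ⟶ v) {P K : V} {a : P ⟶ u.right} {b : P ⟶ v.left}
  {c : K ⟶ P} {d : K ⟶ u.left}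

lemma kernelι_comp_eq_zero (hP : IsWeakPullback a b f.right v.hom)
    (hK : IsWeakPullback c d a u.hom) :
    (quotient V).map (Arrow.homMk (f := Arrow.mk c) d a hK.w.symm) ≫ (quotient V).map f = 0 := by
  rw [← Functor.map_comp, quotient_map_eq_zero_iff_exists]
  exact ⟨b, hP.w⟩

/-- The kernel of a morphism in the right Freyd category, computed by two weak pullbacks. -/
noncomputable def isLimitKernelFork (hP : IsWeakPullback a b f.right v.hom)
    (hK : IsWeakPullback c d a u.hom) :
    IsLimit (KernelFork.ofι _ (kernelι_comp_eq_zero f hP hK)) := by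
  have : Mono ((quotient V).map (Arrow.homMk (f := Arrow.mk c) d a hK.w.symm)) := by
    rw [Preadditive.mono_iff_cancel_zero]
    intro w g hg
    obtain ⟨w, rfl⟩ := obj_surjective w
    obtain ⟨g, rfl⟩ := (quotient V).map_surjective g
    rw [← Functor.map_comp, quotient_map_eq_zero_iff_exists] at hg
    obtain ⟨h, hh⟩ := hg
    rw [quotient_map_eq_zero_iff_exists]
    obtain ⟨l, hl, -⟩ := hK.exists_lift g.right h hh
    exact ⟨l, hl.symm⟩
  refine KernelFork.IsLimit.ofι' _ _ fun {w} g hg => Nonempty.some ?_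
  obtain ⟨w, rfl⟩ := obj_surjective w
  obtain ⟨g, rfl⟩ := (quotient V).map_surjective g
  rw [← Functor.map_comp, quotient_map_eq_zero_iff_exists] at hg
  obtain ⟨h, hh⟩ := hg
  obtain ⟨l, hl, -⟩ := hP.exists_lift g.right h hh
  obtain ⟨m, hm, -⟩ := hK.exists_lift (w.hom ≫ l) g.left (by
    rw [Category.assoc, hl]; exact g.w.symm)
  refine ⟨(quotient V).map (Arrow.homMk m l hm), ?_⟩
  rw [← Functor.map_comp, quotient_map_eq_iff_exists]
  exact ⟨0, by simp [hl]⟩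

end Kernel

section Cokernel

variable {u v : Arrow V} (f : u ⟶ v) {N : V} {inl : v.left ⟶ N} {inr : u.right ⟶ N}
  {p : N ⟶ v.right}

lemma comp_cokernelπ_eq_zero (hl : inl ≫ p = v.hom) (hr : inr ≫ p = f.right) :
    (quotient V).map f ≫
      (quotient V).map (Arrow.homMk (g := Arrow.mk p) inl (𝟙 _) (by simpa using hl)) = 0 := by
  rw [← Functor.map_comp, quotient_map_eq_zero_iff_exists]
  exact ⟨inr, by simpa using hr.symm⟩

/-- The cokernel of a morphism in the right Freyd category, computed by a weak coproduct. -/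
noncomputable def isColimitCokernelCofork (hN : IsWeakCoproduct inl inr) (hl : inl ≫ p = v.hom)
    (hr : inr ≫ p = f.right)
    (hp : ∀ ⦃W : V⦄ (a b : N ⟶ W), inl ≫ a = inl ≫ b → inr ≫ a = inr ≫ b → a = b) :
    IsColimit (CokernelCofork.ofπ _ (comp_cokernelπ_eq_zero f hl hr)) := by
  have : Epi ((quotient V).map (Arrow.homMk (g := Arrow.mk p) inl (𝟙 _) (by simpa using hl))) :=
    have : IsIso (Arrow.homMk (f := v) (g := Arrow.mk p) inl (𝟙 _) (by simpa using hl)).right :=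
      inferInstanceAs (IsIso (𝟙 v.right))
    epi_of_isIso_right _
  refine CokernelCofork.IsColimit.ofπ' _ _ fun {w} g hg => Nonempty.some ?_
  obtain ⟨w, rfl⟩ := obj_surjective w
  obtain ⟨g, rfl⟩ := (quotient V).map_surjective g
  rw [← Functor.map_comp, quotient_map_eq_zero_iff_exists] at hg
  obtain ⟨h, hh⟩ := hg
  obtain ⟨l, hl', hr'⟩ := hN g.left h
  refine ⟨(quotient V).map (Arrow.homMk l g.right (hp _ _ ?_ ?_)), ?_⟩
  · rw [← Category.assoc, hl']
    exact g.w.trans (by rw [← hl, Category.assoc]; rfl)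
  · rw [← Category.assoc, hr']
    exact hh.symm.trans (by rw [← Category.assoc]; exact congrArg (· ≫ g.right) hr.symm)
  · rw [← Functor.map_comp, quotient_map_eq_iff_exists]
    exact ⟨0, by simp⟩

end Cokernel

section OfRight

variable [HasZeroObject V]

/-- The morphism from `P`, seen in the right Freyd category, given by a morphism to the target. -/
noncomputable def ofRight {P : V} {u : Arrow V} (a : P ⟶ u.right) :
    (functor V).obj P ⟶ (quotient V).obj u :=
  (quotient V).map (Arrow.homMk (f := (rightFunctor V).obj P) 0 a
    (zero_comp.trans zero_comp.symm))

lemma ofRight_comp {P : V} {u v : Arrow V} (a : P ⟶ u.right) (f : u ⟶ v) :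
    ofRight a ≫ (quotient V).map f = ofRight (a ≫ f.right) := by
  refine ((quotient V).map_comp _ _).symm.trans ((quotient V).congr_map ?_)
  ext
  · exact zero_comp
  · rfl

lemma ofRight_eq_zero_iff {P : V} {u : Arrow V} (a : P ⟶ u.right) :
    ofRight a = 0 ↔ ∃ h, a = h ≫ u.hom :=
  quotient_map_eq_zero_iff_exists _

end OfRight

section Candidate

variable [HasBinaryBiproducts V]

lemma comp_candidateπ_eq_zero_iff {w u v : Arrow V} (f : u ⟶ v) (g : w ⟶ v) :
    (quotient V).map g ≫ (quotient V).map (Candidate.π f) = 0 ↔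
      ∃ α β, g.right = α ≫ v.hom + β ≫ f.right := by
  rw [← Functor.map_comp, quotient_map_eq_zero_iff_exists]
  have : (g ≫ Candidate.π f).right = g.right := Category.comp_id g.right
  rw [this]
  constructor
  · rintro ⟨k, hk⟩
    refine ⟨k ≫ biprod.fst, k ≫ biprod.snd, ?_⟩
    rw [hk]
    simp only [Arrow.mk_hom, biprod.desc_eq, comp_add, Category.assoc]
  · rintro ⟨α, β, h⟩
    exact ⟨biprod.lift α β, h.trans (by simp)⟩

lemma map_comp_candidateπ {u v : Arrow V} (f : u ⟶ v) :
    (quotient V).map f ≫ (quotient V).map (Candidate.π f) = 0 :=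
  eq_of_rightHomotopy _ _ (Candidate.condition f)

end Candidate

section Abelian

variable [HasPullbacks V]

lemma hasKernels : HasKernels (RightFreyd V) where
  has_limit {X Y} f := by
    obtain ⟨u, rfl⟩ := obj_surjective X
    obtain ⟨v, rfl⟩ := obj_surjective Y
    obtain ⟨f, rfl⟩ := (quotient V).map_surjective f
    obtain ⟨P, a, b, hP⟩ := exists_isWeakPullback f.right v.hom
    obtain ⟨K, c, d, hK⟩ := exists_isWeakPullback a u.hom
    exact ⟨_, isLimitKernelFork f hP hK⟩

variable [HasZeroObject V] [HasBinaryBiproducts V]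

/-- A monomorphism `f` is the kernel of its cokernel. The map from `P` given by `a` is killed by
`f`, hence is zero, so `a` factors through `u.hom`. If `g` dies in the cokernel, then `g.right = α ≫
v.hom + β ≫ f.right`, and `β` is the required lift: `w.hom ≫ β` factors through `a`, hence through
`u.hom`, so `β` respects relations. -/
lemma isNormalMonoCategory : IsNormalMonoCategory (RightFreyd V) where
  normalMonoOfMono {X Y} f hf := by
    obtain ⟨u, rfl⟩ := obj_surjective X
    obtain ⟨v, rfl⟩ := obj_surjective Y
    obtain ⟨f, rfl⟩ := (quotient V).map_surjective f
    obtain ⟨P, a, b, hP⟩ := exists_isWeakPullback f.right v.hom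
    obtain ⟨h, hh⟩ : ∃ h, a = h ≫ u.hom := by
      rw [← ofRight_eq_zero_iff, ← cancel_mono ((quotient V).map f), zero_comp, ofRight_comp,
        ofRight_eq_zero_iff]
      exact ⟨b, hP.w⟩
    refine ⟨⟨_, (quotient V).map (Candidate.π f), map_comp_candidateπ f,
      KernelFork.IsLimit.ofι' _ _ fun {w} g hg => Nonempty.some ?_⟩⟩
    obtain ⟨w, rfl⟩ := obj_surjective w
    obtain ⟨g, rfl⟩ := (quotient V).map_surjective g
    obtain ⟨α, β, hαβ⟩ := (comp_candidateπ_eq_zero_iff _ _).1 hg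
    obtain ⟨l, hl, -⟩ := hP.exists_lift (w.hom ≫ β) (g.left - w.hom ≫ α) (by
      have hw : g.left ≫ v.hom = w.hom ≫ g.right := g.w
      rw [sub_comp, hw, hαβ]
      simp)
    refine ⟨(quotient V).map (Arrow.homMk (l ≫ h) β (by rw [Category.assoc, ← hh, hl])), ?_⟩
    rw [← Functor.map_comp, quotient_map_eq_iff_exists]
    exact ⟨-α, by simp [hαβ]⟩

/-- An epimorphism `f` is the cokernel of the map `P ⟶ u` given by `a`. A map `g` killing that map
descends along `s ≫ g.right`, where `s` is a section of `f.right` modulo the relations `v.hom`. -/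
lemma isNormalEpiCategory : IsNormalEpiCategory (RightFreyd V) where
  normalEpiOfEpi {X Y} f hf := by
    obtain ⟨u, rfl⟩ := obj_surjective X
    obtain ⟨v, rfl⟩ := obj_surjective Y
    obtain ⟨f, rfl⟩ := (quotient V).map_surjective f
    obtain ⟨P, a, b, hP⟩ := exists_isWeakPullback f.right v.hom
    -- The cokernel projection of an epimorphism vanishes, so the identity of `v.right` is a
    -- combination of `v.hom` and `f.right`.
    obtain ⟨t, s, hts⟩ : ∃ t s, 𝟙 v.right = t ≫ v.hom + s ≫ f.right := by
      refine (comp_candidateπ_eq_zero_iff f (𝟙 v)).1 ?_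
      rw [← cancel_epi ((quotient V).map f), comp_zero, Functor.map_id, Category.id_comp,
        map_comp_candidateπ]
    rw [eq_comm, ← eq_sub_iff_add_eq'] at hts
    refine ⟨⟨_, ofRight a, ?_, CokernelCofork.IsColimit.ofπ' _ _ fun {w} g hg => Nonempty.some ?_⟩⟩
    · rw [ofRight_comp, ofRight_eq_zero_iff]
      exact ⟨b, hP.w⟩
    obtain ⟨w, rfl⟩ := obj_surjective w
    obtain ⟨g, rfl⟩ := (quotient V).map_surjective g
    rw [ofRight_comp, ofRight_eq_zero_iff] at hg
    obtain ⟨k, hk⟩ := hg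
    -- The lift `l` shows that `s ≫ g.right` respects the relations of `v`; the lift `m` below shows
    -- that its composite with `f` is homotopic to `g`.
    obtain ⟨l, hl, -⟩ := hP.exists_lift (v.hom ≫ s) (𝟙 _ - v.hom ≫ t) (by
      rw [Category.assoc, hts]; simp)
    obtain ⟨m, hm, -⟩ := hP.exists_lift (f.right ≫ s - 𝟙 _) (-f.right ≫ t) (by
      rw [sub_comp, Category.assoc, hts]; simp)
    refine ⟨(quotient V).map (Arrow.homMk (l ≫ k) (s ≫ g.right) ?_), ?_⟩
    · rw [Category.assoc, ← hk, ← Category.assoc, hl, Category.assoc]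
    · rw [← Functor.map_comp, quotient_map_eq_iff_exists]
      refine ⟨m ≫ k, ?_⟩
      have : (m ≫ k) ≫ w.hom = (f.right ≫ s - 𝟙 _) ≫ g.right := by
        rw [Category.assoc, ← hk, ← Category.assoc, hm]
      rw [this]
      simp

end Abelian

section Biproducts

variable [HasBinaryBiproducts V]

instance : HasBinaryBiproducts (RightFreyd V) where
  has_binary_biproduct X Y := by
    obtain ⟨u, rfl⟩ := obj_surjective X
    obtain ⟨v, rfl⟩ := obj_surjective Y
    have : HasBinaryBiproducts (Arrow V) := HasBinaryBiproducts.of_hasBinaryProducts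
    have := preservesBinaryBiproduct_of_preservesBiproduct (quotient V) u v
    exact (quotient V).hasBinaryBiproduct_of_preserves u v

instance [HasZeroObject V] : HasFiniteProducts (RightFreyd V) :=
  hasFiniteProducts_of_has_binary_and_terminal

end Biproducts

/-- The right Freyd category of an additive category with pullbacks is abelian. -/
noncomputable abbrev abelian [HasZeroObject V] [HasBinaryBiproducts V] [HasPullbacks V] :
    Abelian (RightFreyd V) :=
  have := hasKernels (V := V)
  have := isNormalMonoCategory (V := V)
  have := isNormalEpiCategory (V := V)
  { }

end

end CategoryTheory.Preadditive.RightFreyd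

/-! ### Exactness of the functor on `mod` induced by an additive functor. -/

namespace CategoryTheory.Functor

variable {V W : Type*} [Category* V] [Preadditive V] [Category* W] [Preadditive W]
  (F : V ⥤ W) [F.Additive] {X Y : V} [HasBinaryBiproduct X Y]

lemma map_biprod_hom_ext {T : W} {a b : F.obj (X ⊞ Y) ⟶ T}
    (hl : F.map biprod.inl ≫ a = F.map biprod.inl ≫ b)
    (hr : F.map biprod.inr ≫ a = F.map biprod.inr ≫ b) : a = b := by
  have e : 𝟙 (F.obj (X ⊞ Y)) =
      F.map biprod.fst ≫ F.map biprod.inl + F.map biprod.snd ≫ F.map biprod.inr := by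
    rw [← F.map_comp, ← F.map_comp, ← F.map_add, biprod.total, F.map_id]
  rw [← Category.id_comp a, ← Category.id_comp b, e]
  simp only [add_comp, Category.assoc, hl, hr]

lemma map_biprod_isWeakCoproduct :
    IsWeakCoproduct (F.map (biprod.inl : X ⟶ X ⊞ Y)) (F.map (biprod.inr : Y ⟶ X ⊞ Y)) :=
  fun _ a b => ⟨F.map biprod.fst ≫ a + F.map biprod.snd ≫ b,
    by simp [← Functor.map_comp_assoc], by simp [← Functor.map_comp_assoc]⟩

end CategoryTheory.Functor

namespace CategoryTheory.Preadditive.RightFreyd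

section Map

variable {V W : Type*} [Category* V] [Preadditive V] [Category* W] [Preadditive W]
  (F : V ⥤ W) [F.Additive]

/-- A kernel in `mod(V)` is assembled from two pullbacks, and `F` preserves both. -/
lemma rightFreydMap_preservesKernel [HasPullbacks V] [PreservesLimitsOfShape WalkingCospan F]
    {X Y : RightFreyd V} (f : X ⟶ Y) : PreservesLimit (parallelPair f 0) (rightFreydMap F) := by
  obtain ⟨u, rfl⟩ := obj_surjective X
  obtain ⟨v, rfl⟩ := obj_surjective Y
  obtain ⟨f, rfl⟩ := (quotient V).map_surjective f
  have hP := (IsPullback.of_hasPullback f.right v.hom)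
  have hK := (IsPullback.of_hasPullback (pullback.fst f.right v.hom) u.hom)
  exact preservesLimit_of_preserves_limit_cone
    (isLimitKernelFork f hP.isWeakPullback hK.isWeakPullback)
    ((KernelFork.isLimitMapConeEquiv _ _).2 (isLimitKernelFork (F.mapArrow.map f)
      (hP.map F).isWeakPullback (hK.map F).isWeakPullback))

lemma rightFreydMap_preservesCokernel [HasBinaryBiproducts V]
    {X Y : RightFreyd V} (f : X ⟶ Y) : PreservesColimit (parallelPair f 0) (rightFreydMap F) := by
  obtain ⟨u, rfl⟩ := obj_surjective X
  obtain ⟨v, rfl⟩ := obj_surjective Y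
  obtain ⟨f, rfl⟩ := (quotient V).map_surjective f
  have h1 : biprod.inl ≫ biprod.desc v.hom f.right = v.hom := biprod.inl_desc _ _
  have h2 : biprod.inr ≫ biprod.desc v.hom f.right = f.right := biprod.inr_desc _ _
  have hl := (F.map_comp _ _).symm.trans (congrArg F.map h1)
  have hr := (F.map_comp _ _).symm.trans (congrArg F.map h2)
  have c1 : IsColimit (CokernelCofork.ofπ _ (comp_cokernelπ_eq_zero f h1 h2)) :=
    isColimitCokernelCofork f (fun W a b => ⟨biprod.desc a b, by simp, by simp⟩) h1 h2
      (fun W a b => biprod.hom_ext' _ _)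
  -- The cokernel in `mod(W)` is computed with the image of the biproduct itself, so no comparison
  -- with a biproduct of images enters.
  have c2 : IsColimit (CokernelCofork.ofπ _ (comp_cokernelπ_eq_zero (F.mapArrow.map f) hl hr)) :=
    isColimitCokernelCofork (F.mapArrow.map f) F.map_biprod_isWeakCoproduct hl hr
      (fun _ _ _ => F.map_biprod_hom_ext)
  refine preservesColimit_of_preserves_colimit_cocone c1
    ((CokernelCofork.isColimitMapCoconeEquiv _ _).2 (IsColimit.ofIsoColimit c2
      (Cofork.ext (Iso.refl _) ?_)))
  refine (Category.comp_id _).trans ((quotient W).congr_map ?_)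
  ext
  · rfl
  · exact (F.map_id _).symm

/-- The functor on right Freyd categories commutes with the canonical functors. -/
noncomputable def functorMapIso [HasZeroObject V] [HasZeroObject W] :
    functor V ⋙ rightFreydMap F ≅ F ⋙ functor W :=
  NatIso.ofComponents
    (fun X => (quotient W).mapIso (Arrow.isoMk (f := F.mapArrow.obj ((rightFunctor V).obj X))
      (g := (rightFunctor W).obj (F.obj X)) F.mapZeroObject (Iso.refl _)
        ((F.map_isZero (isZero_zero V)).eq_of_src _ _)))
    (fun f => by
      refine ((quotient W).map_comp (F.mapArrow.map ((rightFunctor V).map f)) _).symm.trans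
        (((quotient W).congr_map ?_).trans ((quotient W).map_comp _ _))
      ext
      · exact (F.map_isZero (isZero_zero V)).eq_of_src _ _
      · exact (Category.comp_id _).trans (Category.id_comp _).symm)

end Map

/-! ### Evaluating formal cokernels in an abelian category. -/

section CokernelFunctor

variable (A : Type*) [Category* A] [Abelian A]

/-- The functor sending a formal cokernel of an abelian category to the actual cokernel. -/
noncomputable def cokernelFunctor : RightFreyd A ⥤ A :=
  CategoryTheory.Quotient.lift _
    { obj := fun u => cokernel u.hom
      map := fun {u v} f => cokernel.map u.hom v.hom f.left f.right f.w.symm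
      map_id := fun _ => by ext; simp
      map_comp := fun _ _ => by ext; simp }
    (by
      rintro u v f g ⟨h⟩
      ext
      simp [sub_eq_iff_eq_add.1 h.comm])

variable {A}

/-- The projection to the actual cokernel of an arrow. -/
noncomputable def toCokernel (u : Arrow A) :
    u.right ⟶ (cokernelFunctor A).obj ((quotient A).obj u) :=
  cokernel.π u.hom

instance (u : Arrow A) : Epi (toCokernel u) :=
  inferInstanceAs (Epi (cokernel.π u.hom))

lemma hom_comp_toCokernel (u : Arrow A) : u.hom ≫ toCokernel u = 0 :=
  cokernel.condition u.hom

/-- The universal property of the actual cokernel of an arrow. -/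
noncomputable def isColimitToCokernel (u : Arrow A) :
    IsColimit (CokernelCofork.ofπ (toCokernel u) (hom_comp_toCokernel u)) :=
  cokernelIsCokernel u.hom

lemma toCokernel_desc (u : Arrow A) {T : A} (g : u.right ⟶ T) (h : u.hom ≫ g = 0) :
    ∃ l, toCokernel u ≫ l = g :=
  ⟨_, (CokernelCofork.IsColimit.desc' (isColimitToCokernel u) g h).2⟩

lemma toCokernel_naturality {u v : Arrow A} (f : u ⟶ v) :
    toCokernel u ≫ (cokernelFunctor A).map ((quotient A).map f) = f.right ≫ toCokernel v :=
  cokernel.π_desc _ _ _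

instance : (cokernelFunctor A).Additive where
  map_add {X Y f g} := by
    obtain ⟨u, rfl⟩ := obj_surjective X
    obtain ⟨v, rfl⟩ := obj_surjective Y
    obtain ⟨f, rfl⟩ := (quotient A).map_surjective f
    obtain ⟨g, rfl⟩ := (quotient A).map_surjective g
    rw [← Functor.map_add, ← cancel_epi (toCokernel u), comp_add, toCokernel_naturality,
      toCokernel_naturality, toCokernel_naturality, ← add_comp]
    rfl

/-- A map out of `v.right` killing both `v.hom` and `f.right` is the same as a map out of the
cokernel of `v.hom` killing the map induced by `f`. -/
lemma cokernelFunctor_preservesCokernel {X Y : RightFreyd A} (f : X ⟶ Y) :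
    PreservesColimit (parallelPair f 0) (cokernelFunctor A) := by
  obtain ⟨u, rfl⟩ := obj_surjective X
  obtain ⟨v, rfl⟩ := obj_surjective Y
  obtain ⟨f, rfl⟩ := (quotient A).map_surjective f
  let π := (cokernelFunctor A).map ((quotient A).map (Candidate.π f))
  have hπ : toCokernel v ≫ π = toCokernel (Candidate.cokernel f) :=
    (toCokernel_naturality (Candidate.π f)).trans (Category.id_comp _)
  have : Epi π := epi_of_epi_fac hπ
  have w : (cokernelFunctor A).map ((quotient A).map f) ≫ π = 0 := by
    rw [← Functor.map_comp, map_comp_candidateπ, Functor.map_zero]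
  have c : IsColimit (CokernelCofork.ofπ π w) :=
    CokernelCofork.IsColimit.ofπ' _ _ fun {T} g hg => Nonempty.some <| by
      obtain ⟨l, hl⟩ := toCokernel_desc (Candidate.cokernel f) (toCokernel v ≫ g) (by
        refine biprod.hom_ext' _ _ ?_ ?_
        · simp [reassoc_of% (hom_comp_toCokernel v)]
        · simp [← reassoc_of% (toCokernel_naturality f), hg])
      exact ⟨l, by rw [← cancel_epi (toCokernel v), ← Category.assoc, hπ, hl]⟩
  exact preservesColimit_of_preserves_colimit_cocone (Candidate.isColimitCokernelCofork f)
    ((CokernelCofork.isColimitMapCoconeEquiv _ _).2 c)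

/-- A diagram chase with generalised elements: an element of the cokernel of `u.hom` killed by `f`
lifts to `u.right`, where its image under `f.right` comes from `v.left`, so the lift comes from `P`.
Injectivity is the same chase with `K`. -/
lemma cokernelFunctor_preservesKernel {X Y : RightFreyd A} (f : X ⟶ Y) :
    PreservesLimit (parallelPair f 0) (cokernelFunctor A) := by
  obtain ⟨u, rfl⟩ := obj_surjective X
  obtain ⟨v, rfl⟩ := obj_surjective Y
  obtain ⟨f, rfl⟩ := (quotient A).map_surjective f
  obtain ⟨P, a, b, hP⟩ := exists_isWeakPullback f.right v.hom
  obtain ⟨K, c, d, hK⟩ := exists_isWeakPullback a u.hom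
  -- An element of `u.right` vanishing in the cokernel comes from `u.left` after passing to an
  -- epimorphic cover of its domain.
  have key (u : Arrow A) {T : A} (x : T ⟶ u.right) (hx : x ≫ toCokernel u = 0) :
      ∃ (T' : A) (π : T' ⟶ T) (_ : Epi π) (y : T' ⟶ u.left), π ≫ x = y ≫ u.hom :=
    (ShortComplex.exact_of_g_is_cokernel (ShortComplex.mk u.hom _ (hom_comp_toCokernel u))
      (isColimitToCokernel u)).exact_up_to_refinements x hx
  let k := (cokernelFunctor A).map ((quotient A).map (Arrow.homMk (f := Arrow.mk c) d a hK.w.symm))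
  have hk : toCokernel (Arrow.mk c) ≫ k = a ≫ toCokernel u :=
    toCokernel_naturality (Arrow.homMk (f := Arrow.mk c) d a hK.w.symm)
  let g := (cokernelFunctor A).map ((quotient A).map f)
  have hg : toCokernel u ≫ g = f.right ≫ toCokernel v := toCokernel_naturality f
  have w : k ≫ g = 0 := by
    rw [← Functor.map_comp, kernelι_comp_eq_zero f hP hK, Functor.map_zero]
  have : Mono k := by
    rw [Preadditive.mono_iff_cancel_zero]
    intro T x hx
    obtain ⟨T₁, π₁, _, x₁, h₁⟩ := surjective_up_to_refinements_of_epi (toCokernel (Arrow.mk c)) x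
    obtain ⟨T₂, π₂, _, y, h₂⟩ := key u (x₁ ≫ a) (by
      refine (Category.assoc _ _ _).trans ?_
      rw [← hk, ← Category.assoc, ← h₁, Category.assoc, hx, comp_zero])
    obtain ⟨l, hl, -⟩ := hK.exists_lift (π₂ ≫ x₁) y ((Category.assoc _ _ _).trans h₂)
    have hc : c ≫ toCokernel (Arrow.mk c) = 0 := hom_comp_toCokernel (Arrow.mk c)
    rw [← cancel_epi π₁, ← cancel_epi π₂, h₁, ← Category.assoc, ← hl, Category.assoc, hc]
    simp
  have ex : (ShortComplex.mk k g w).Exact := by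
    rw [ShortComplex.exact_iff_exact_up_to_refinements]
    intro T x hx
    obtain ⟨T₁, π₁, _, x₁, h₁⟩ := surjective_up_to_refinements_of_epi (toCokernel u) x
    obtain ⟨T₂, π₂, _, y, h₂⟩ := key v (x₁ ≫ f.right) (by
      rw [Category.assoc, ← hg, ← Category.assoc, ← h₁, Category.assoc]
      exact (congrArg (π₁ ≫ ·) hx).trans comp_zero)
    obtain ⟨l, hl, -⟩ := hP.exists_lift (π₂ ≫ x₁) y (by rw [Category.assoc, h₂])
    refine ⟨T₂, π₂ ≫ π₁, inferInstance, l ≫ toCokernel (Arrow.mk c), ?_⟩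
    change _ = (l ≫ toCokernel (Arrow.mk c)) ≫ k
    rw [Category.assoc, h₁, Category.assoc, hk, ← Category.assoc l, hl, Category.assoc]
  exact preservesLimit_of_preserves_limit_cone (isLimitKernelFork f hP hK)
    ((KernelFork.isLimitMapConeEquiv _ _).2 ex.fIsKernel)

open ZeroObject in
lemma isIso_toCokernel (X : A) : IsIso (toCokernel ((rightFunctor A).obj X)) :=
  inferInstanceAs (IsIso (cokernel.π (0 : 0 ⟶ X)))

/-- The cokernel functor is a retraction of the canonical functor. -/
noncomputable def functorCokernelFunctorIso : functor A ⋙ cokernelFunctor A ≅ 𝟭 A :=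
  (NatIso.ofComponents (fun X => @asIso _ _ _ _ _ (isIso_toCokernel X))
    (fun f => (toCokernel_naturality ((rightFunctor A).map f)).symm)).symm

end CokernelFunctor

end CategoryTheory.Preadditive.RightFreyd

/-! ### The universal property of `mod(V)` for right exact functors. -/

namespace CategoryTheory.Preadditive.RightFreyd

instance {V : Type*} [Category* V] [Preadditive V] [HasBinaryBiproducts V] [HasZeroObject V] :
    HasFiniteColimits (RightFreyd V) :=
  have : HasCoequalizers (RightFreyd V) := Preadditive.hasCoequalizers_of_hasCokernels
  have := HasFiniteBiproducts.of_hasFiniteProducts (C := RightFreyd V)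
  hasFiniteColimits_of_hasCoequalizers_and_finite_coproducts

instance {V : Type*} [Category* V] [Preadditive V] [HasBinaryBiproducts V] [HasZeroObject V] :
    HasBinaryBiproducts (RightFreyd V)ᵒᵖ :=
  HasBinaryBiproducts.of_hasBinaryProducts

section Exact

variable {V W : Type*} [Category* V] [Preadditive V] [Category* W] [Preadditive W]
  (F : V ⥤ W) [F.Additive] [HasBinaryBiproducts V] [HasZeroObject V] [HasZeroObject W]

instance : PreservesFiniteColimits (rightFreydMap F) :=
  have := fun {X Y : RightFreyd V} (f : X ⟶ Y) => rightFreydMap_preservesCokernel F f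
  Functor.preservesFiniteColimits_of_preservesCokernels _

instance [HasPullbacks V] [PreservesFiniteLimits F] : PreservesFiniteLimits (rightFreydMap F) :=
  letI := abelian (V := V)
  have := fun {X Y : RightFreyd V} (f : X ⟶ Y) => rightFreydMap_preservesKernel F f
  Functor.preservesFiniteLimits_of_preservesKernels _

end Exact

section CokernelFunctor

variable (A : Type*) [Category* A] [Abelian A]

instance : PreservesFiniteColimits (cokernelFunctor A) :=
  letI := abelian (V := A)
  have := fun {X Y : RightFreyd A} (f : X ⟶ Y) => cokernelFunctor_preservesCokernel f
  Functor.preservesFiniteColimits_of_preservesCokernels _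

instance : PreservesFiniteLimits (cokernelFunctor A) :=
  letI := abelian (V := A)
  have := fun {X Y : RightFreyd A} (f : X ⟶ Y) => cokernelFunctor_preservesKernel f
  Functor.preservesFiniteLimits_of_preservesKernels _

end CokernelFunctor

section Lift

variable {V : Type*} [Category* V] [Preadditive V] [HasZeroObject V] [HasBinaryBiproducts V]
  {A : Type*} [Category* A] [Abelian A] (F : V ⥤ A) [F.Additive]

/-- The right exact extension of an additive functor to the right Freyd category. -/
noncomputable def lift : RightFreyd V ⥤ A :=
  rightFreydMap F ⋙ cokernelFunctor A

instance : (lift F).Additive :=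
  inferInstanceAs (rightFreydMap F ⋙ cokernelFunctor A).Additive

instance : PreservesFiniteColimits (lift F) :=
  comp_preservesFiniteColimits (rightFreydMap F) (cokernelFunctor A)

instance [HasPullbacks V] [PreservesFiniteLimits F] : PreservesFiniteLimits (lift F) :=
  comp_preservesFiniteLimits (rightFreydMap F) (cokernelFunctor A)

/-- The extension of a functor to the right Freyd category restricts to that functor. -/
noncomputable def functorLiftIso : functor V ⋙ lift F ≅ F :=
  (Functor.associator _ _ _).symm ≪≫ Functor.isoWhiskerRight (functorMapIso F) _ ≪≫
    Functor.associator _ _ _ ≪≫ Functor.isoWhiskerLeft F functorCokernelFunctorIso ≪≫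
    F.rightUnitor

end Lift

section Unique

variable {V : Type*} [Category* V] [Preadditive V] [HasZeroObject V]

/-- Each object of `mod(V)` is the actual cokernel of the arrow defining it; this presentation is
what determines right exact functors by their values on `V`. -/
lemma functor_map_hom_comp_ofRight (u : Arrow V) :
    (functor V).map u.hom ≫ ofRight (u := u) (𝟙 u.right) = 0 :=
  comp_cokernelπ_eq_zero ((rightFunctor V).map u.hom) (inl := 0) (inr := 𝟙 u.left) (p := u.hom)
    zero_comp (Category.id_comp _)

/-- The canonical presentation of an object of the right Freyd category. -/
noncomputable def isColimitPresentation (u : Arrow V) :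
    IsColimit (CokernelCofork.ofπ _ (functor_map_hom_comp_ofRight u)) :=
  isColimitCokernelCofork ((rightFunctor V).map u.hom) (inl := 0) (inr := 𝟙 u.left) (p := u.hom)
    (fun _ _ b => ⟨b, (isZero_zero V).eq_of_src _ _, Category.id_comp b⟩)
    zero_comp (Category.id_comp _)
    (fun _ a b _ h => (Category.id_comp a).symm.trans (h.trans (Category.id_comp b)))

variable {A : Type*} [Category* A] [Preadditive A] {F G : RightFreyd V ⥤ A}
  [F.PreservesZeroMorphisms] [G.PreservesZeroMorphisms]
  [PreservesFiniteColimits F] [PreservesFiniteColimits G]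

/-- The comparison of two right exact functors which agree on the generating objects. -/
lemma exists_iso_of_functor_comp_iso (α : functor V ⋙ F ≅ functor V ⋙ G) (u : Arrow V) :
    ∃ e : F.obj ((quotient V).obj u) ≅ G.obj ((quotient V).obj u),
      F.map (ofRight (u := u) (𝟙 u.right)) ≫ e.hom =
        α.hom.app u.right ≫ G.map (ofRight (u := u) (𝟙 u.right)) := by
  let hF := CokernelCofork.mapIsColimit _ (isColimitPresentation u) F
  let hG := CokernelCofork.mapIsColimit _ (isColimitPresentation u) G
  let φ : Arrow.mk (F.map ((functor V).map u.hom)) ≅ Arrow.mk (G.map ((functor V).map u.hom)) :=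
    Arrow.isoMk (α.app u.left) (α.app u.right) (α.hom.naturality u.hom).symm
  exact ⟨CokernelCofork.mapIsoOfIsColimit hF hG φ, CokernelCofork.π_mapOfIsColimit hF _ φ.hom⟩

/-- Two right exact functors on the right Freyd category are isomorphic if their restrictions
to the original category are. -/
lemma nonempty_iso_of_functor_comp_iso (α : functor V ⋙ F ≅ functor V ⋙ G) :
    Nonempty (F ≅ G) := by
  choose e he using exists_iso_of_functor_comp_iso α
  have epi (u : Arrow V) : Epi (F.map (ofRight (u := u) (𝟙 u.right))) :=
    Cofork.IsColimit.epi (CokernelCofork.mapIsColimit _ (isColimitPresentation u) F)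
  refine ⟨NatIso.ofComponents (fun X => e X.as) fun {X Y} f => ?_⟩
  obtain ⟨u, rfl⟩ := obj_surjective X
  obtain ⟨v, rfl⟩ := obj_surjective Y
  obtain ⟨f, rfl⟩ := (quotient V).map_surjective f
  change F.map _ ≫ (e v).hom = (e u).hom ≫ G.map _
  have h : ofRight (u := u) (𝟙 u.right) ≫ (quotient V).map f =
      (functor V).map f.right ≫ ofRight (u := v) (𝟙 v.right) := by
    refine ((quotient V).map_comp _ _).symm.trans
      (((quotient V).congr_map ?_).trans ((quotient V).map_comp _ _))
    ext
    · exact (isZero_zero V).eq_of_src _ _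
    · exact (Category.id_comp _).trans (Category.comp_id _).symm
  rw [← cancel_epi (F.map (ofRight (u := u) (𝟙 u.right))), ← F.map_comp_assoc, h, F.map_comp,
    Category.assoc, he, reassoc_of% (he u), ← G.map_comp, h, G.map_comp]
  exact (α.hom.naturality_assoc f.right _)

end Unique

end CategoryTheory.Preadditive.RightFreyd

/-! ### Left exactness of the embedding of `V` into `mod(V)`. -/

namespace CategoryTheory.Preadditive.RightFreyd

variable {V : Type*} [Category* V] [Preadditive V] [HasZeroObject V]

lemma quotient_map_to_functor_eq_zero_iff {u : Arrow V} {X : V} (g : u ⟶ (rightFunctor V).obj X) :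
    (quotient V).map g = 0 ↔ g.right = 0 := by
  rw [quotient_map_eq_zero_iff_exists]
  exact ⟨fun ⟨h, hh⟩ => hh.trans comp_zero, fun h => ⟨0, h.trans zero_comp.symm⟩⟩

lemma hom_comp_right_eq_zero {u : Arrow V} {X : V} (g : u ⟶ (rightFunctor V).obj X) :
    u.hom ≫ g.right = 0 :=
  g.w.symm.trans comp_zero

/-- A map from a formal cokernel `u` to an object of `V` is just a map out of `u.right` killing
`u.hom`, with no homotopies to divide out. The universal property of the kernel in `V` can therefore
be applied to the component `g.right`. -/
lemma functor_preservesKernel {X Y : V} (f : X ⟶ Y) :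
    PreservesLimit (parallelPair f 0) (functor V) := by
  refine ⟨fun {c} hc => ⟨(KernelFork.isLimitMapConeEquiv c (functor V)).2 ?_⟩⟩
  have hι : Mono (Fork.ι c) := Fork.IsLimit.mono hc
  have : Mono ((functor V).map (Fork.ι c)) := by
    rw [Preadditive.mono_iff_cancel_zero]
    intro T g hg
    obtain ⟨T, rfl⟩ := obj_surjective T
    obtain ⟨g, rfl⟩ := (quotient V).map_surjective g
    rw [Functor.comp_map, ← Functor.map_comp, quotient_map_to_functor_eq_zero_iff] at hg
    rw [quotient_map_to_functor_eq_zero_iff]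
    exact (cancel_mono (Fork.ι c)).1 (hg.trans zero_comp.symm)
  have w : (functor V).map (Fork.ι c) ≫ (functor V).map f = 0 := by
    rw [← Functor.map_comp, KernelFork.condition, Functor.map_zero]
  refine KernelFork.IsLimit.ofι' _ w fun {T} g hg => Nonempty.some ?_
  obtain ⟨T, rfl⟩ := obj_surjective T
  obtain ⟨g, rfl⟩ := (quotient V).map_surjective g
  rw [Functor.comp_map, ← Functor.map_comp, quotient_map_to_functor_eq_zero_iff] at hg
  obtain ⟨l, hl⟩ := KernelFork.IsLimit.lift' hc g.right hg
  refine ⟨(quotient V).map (Arrow.homMk (g := (rightFunctor V).obj c.pt) 0 l ?_), ?_⟩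
  · have h : T.hom ≫ l = 0 := by
      rw [← cancel_mono (Fork.ι c), Category.assoc, hl, zero_comp]
      exact hom_comp_right_eq_zero g
    exact zero_comp.trans h.symm
  · refine ((quotient V).map_comp _ _).symm.trans ((quotient V).congr_map ?_)
    ext
    · exact (isZero_zero V).eq_of_tgt _ _
    · exact hl

instance [HasBinaryBiproducts V] [HasPullbacks V] : PreservesFiniteLimits (functor V) :=
  have : HasEqualizers V := hasEqualizers_of_hasPullbacks_and_binary_products
  have : HasFiniteProducts V := hasFiniteProducts_of_has_binary_and_terminal
  have := fun {X Y : V} (f : X ⟶ Y) => functor_preservesKernel f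
  Functor.preservesFiniteLimits_of_preservesKernels _

end CategoryTheory.Preadditive.RightFreyd

/-! ### The abelian hull and its universal property for exact functors. -/

namespace AbHull

variable {B : Type u} [Category.{w} B] [Preadditive B] [HasZeroObject B] [HasBinaryBiproducts B]

/-- The abelian hull of an additive category is abelian. -/
noncomputable instance : Abelian (AbHull B) :=
  -- The pullbacks required of `(RightFreyd B)ᵒᵖ` are pushouts in `RightFreyd B`, which has all
  -- finite colimits.
  letI := RightFreyd.abelian (V := (RightFreyd B)ᵒᵖ)
  inferInstance

section Map

variable {D : Type u} [Category.{w} D] [Preadditive D] [HasZeroObject D] [HasBinaryBiproducts D]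
  (F : B ⥤ D) [F.Additive]

/-- Right exactness at the first step becomes left exactness after taking opposites, and this is the
input that makes the second step exact on both sides. -/
instance : PreservesFiniteLimits (rightFreydMap F).op :=
  preservesFiniteLimits_op _

instance : PreservesFiniteLimits (abHullMap F) :=
  preservesFiniteLimits_op _

instance : PreservesFiniteColimits (abHullMap F) :=
  preservesFiniteColimits_op _

/-- The canonical functors to the abelian hulls are natural. -/
noncomputable def embeddingMapIso :
    abHullEmbedding B ⋙ abHullMap F ≅ F ⋙ abHullEmbedding D :=
  let e := RightFreyd.functorMapIso (rightFreydMap F).op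
  (Functor.associator _ _ _) ≪≫ Functor.isoWhiskerLeft (RightFreyd.functor B)
    (NatIso.ofComponents (fun X => ((e.app (.op X)).op).symm)
      (fun f => Quiver.Hom.unop_inj (e.inv.naturality f.op).symm) :
      (RightFreyd.functor (RightFreyd B)ᵒᵖ).rightOp ⋙ abHullMap F ≅
        rightFreydMap F ⋙ (RightFreyd.functor (RightFreyd D)ᵒᵖ).rightOp) ≪≫
    (Functor.associator _ _ _).symm ≪≫ Functor.isoWhiskerRight (RightFreyd.functorMapIso F) _ ≪≫
    Functor.associator _ _ _

end Map

section Lift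

variable {A : Type u'} [Category.{w'} A] [Abelian A] (F : B ⥤ A) [F.Additive]

instance : PreservesFiniteLimits (RightFreyd.lift F).op :=
  preservesFiniteLimits_op _

/-- The exact extension of an additive functor to the abelian hull. -/
noncomputable def lift : AbHull B ⥤ A :=
  (RightFreyd.lift (RightFreyd.lift F).op).leftOp

instance : PreservesFiniteLimits (lift F) :=
  preservesFiniteLimits_leftOp _

instance : PreservesFiniteColimits (lift F) :=
  preservesFiniteColimits_leftOp _

/-- The extension of a functor to the abelian hull restricts to that functor. -/
noncomputable def embeddingLiftIso : abHullEmbedding B ⋙ lift F ≅ F :=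
  let e := RightFreyd.functorLiftIso (RightFreyd.lift F).op
  (Functor.associator _ _ _) ≪≫ Functor.isoWhiskerLeft (RightFreyd.functor B)
    (NatIso.ofComponents (fun X => ((e.app (.op X)).unop).symm)
      (fun f => Quiver.Hom.op_inj (e.inv.naturality f.op).symm) :
      (RightFreyd.functor (RightFreyd B)ᵒᵖ).rightOp ⋙ lift F ≅ RightFreyd.lift F) ≪≫
    RightFreyd.functorLiftIso F

end Lift

section Unique

variable {A : Type u'} [Category.{w'} A] [Preadditive A] {F G : AbHull B ⥤ A}
  [F.Additive] [G.Additive]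
  [PreservesFiniteColimits F] [PreservesFiniteColimits G]
  [PreservesFiniteLimits F] [PreservesFiniteLimits G]

/-- Two exact functors on the abelian hull are isomorphic if their restrictions to the original
category are. -/
lemma nonempty_iso_of_embedding_comp_iso (α : abHullEmbedding B ⋙ F ≅ abHullEmbedding B ⋙ G) :
    Nonempty (F ≅ G) := by
  let J := RightFreyd.functor (RightFreyd B)ᵒᵖ
  -- Uniqueness is applied twice. As `J` is left exact, the restrictions of `F` and `G` to `mod(B)`
  -- are right exact, so they are determined by `B`; then `F.rightOp` and `G.rightOp` are right
  -- exact because `F` and `G` are left exact, so they are determined by those restrictions.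
  have : PreservesFiniteColimits J.rightOp := preservesFiniteColimits_rightOp _
  have : PreservesFiniteColimits (J.rightOp ⋙ F) := comp_preservesFiniteColimits _ _
  have : PreservesFiniteColimits (J.rightOp ⋙ G) := comp_preservesFiniteColimits _ _
  obtain ⟨β⟩ := RightFreyd.nonempty_iso_of_functor_comp_iso (F := J.rightOp ⋙ F)
    (G := J.rightOp ⋙ G) α
  have : PreservesFiniteColimits F.rightOp := preservesFiniteColimits_rightOp _
  have : PreservesFiniteColimits G.rightOp := preservesFiniteColimits_rightOp _
  obtain ⟨γ⟩ := RightFreyd.nonempty_iso_of_functor_comp_iso (F := F.rightOp) (G := G.rightOp)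
    (NatIso.ofComponents (fun X => ((β.app X.unop).op).symm)
      (fun f => Quiver.Hom.unop_inj (β.inv.naturality f.unop).symm))
  exact ⟨NatIso.ofComponents (fun X => ((γ.app X.unop).unop).symm)
      (fun f => Quiver.Hom.op_inj (γ.inv.naturality f.unop).symm)⟩

end Unique

end AbHull

/-! ### Additive extension of functors to the `ℤ`-linearisation. -/

namespace FreeExtension

variable {C : Type u} [Category.{w} C] {A : Type u'} [Category.{w'} A] [Preadditive A]

lemma obj_surjective (X : Free ℤ C) : ∃ Y : C, (Free.embedding ℤ C).obj Y = X := ⟨X, rfl⟩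

/-- Morphisms of the `ℤ`-linearisation are determined additively by morphisms of the category. -/
lemma hom_induction {X Y : C}
    {p : ((Free.embedding ℤ C).obj X ⟶ (Free.embedding ℤ C).obj Y) → Prop}
    (f : (Free.embedding ℤ C).obj X ⟶ (Free.embedding ℤ C).obj Y)
    (zero : p 0) (add : ∀ f g, p f → p g → p (f + g))
    (single : ∀ (f : X ⟶ Y) (n : ℤ), p (n • (Free.embedding ℤ C).map f)) : p f := by
  refine Finsupp.induction_linear f zero add fun f n => ?_
  have : n • (Free.embedding ℤ C).map f = Finsupp.single f n := by
    refine (Finsupp.smul_single n f 1).trans ?_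
    simp
  exact this ▸ single f n

/-- The additive extension of a functor to the `ℤ`-linearisation, on morphisms. -/
noncomputable def mapHom (G : C ⥤ A) (X Y : C) :
    ((Free.embedding ℤ C).obj X ⟶ (Free.embedding ℤ C).obj Y) →+ (G.obj X ⟶ G.obj Y) :=
  Finsupp.liftAddHom fun f : X ⟶ Y => (zmultiplesHom _) (G.map f)

lemma mapHom_embedding (G : C ⥤ A) {X Y : C} (f : X ⟶ Y) :
    mapHom G X Y ((Free.embedding ℤ C).map f) = G.map f :=
  (Finsupp.liftAddHom_apply_single (fun f : X ⟶ Y => zmultiplesHom _ (G.map f)) f (1 : ℤ)).trans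
    (by simp)

lemma mapHom_comp (G : C ⥤ A) {X Y Z : C}
    (f : (Free.embedding ℤ C).obj X ⟶ (Free.embedding ℤ C).obj Y)
    (g : (Free.embedding ℤ C).obj Y ⟶ (Free.embedding ℤ C).obj Z) :
    mapHom G X Z (f ≫ g) = mapHom G X Y f ≫ mapHom G Y Z g := by
  refine hom_induction (p := fun f => mapHom G X Z (f ≫ g) = mapHom G X Y f ≫ mapHom G Y Z g) f
    ?_ (fun _ _ h₁ h₂ => ?_) fun f n => ?_
  · rw [zero_comp, map_zero, map_zero, zero_comp]
  · rw [add_comp, map_add, map_add, add_comp, h₁, h₂]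
  refine hom_induction (p := fun g => mapHom G X Z (_ ≫ g) = mapHom G X Y _ ≫ mapHom G Y Z g) g
    ?_ (fun _ _ h₁ h₂ => ?_) fun g m => ?_
  · rw [comp_zero, map_zero, map_zero, comp_zero]
  · rw [comp_add, map_add, map_add, comp_add, h₁, h₂]
  · simp only [map_zsmul, zsmul_comp, comp_zsmul]
    rw [← Functor.map_comp, mapHom_embedding, mapHom_embedding, mapHom_embedding, G.map_comp]

/-- The additive extension of a functor to the `ℤ`-linearisation. -/
noncomputable def lift (G : C ⥤ A) : Free ℤ C ⥤ A where
  obj X := G.obj X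
  map {X Y} f := mapHom G X Y f
  map_id X := (mapHom_embedding G (𝟙 (show C from X))).trans (G.map_id _)
  map_comp f g := mapHom_comp G f g

instance (G : C ⥤ A) : (lift G).Additive where
  map_add {X Y f g} := map_add (mapHom G X Y) f g

/-- The extension to the `ℤ`-linearisation restricts to the given functor. -/
noncomputable def embeddingLiftIso (G : C ⥤ A) : Free.embedding ℤ C ⋙ lift G ≅ G :=
  NatIso.ofComponents (fun _ => Iso.refl _) (fun f =>
    (Category.comp_id _).trans ((mapHom_embedding G f).trans (Category.id_comp _).symm))

/-- Additive functors on the `ℤ`-linearisation are determined by their restriction. -/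
noncomputable def ext {F G : Free ℤ C ⥤ A} [F.Additive] [G.Additive]
    (α : Free.embedding ℤ C ⋙ F ≅ Free.embedding ℤ C ⋙ G) : F ≅ G :=
  NatIso.ofComponents (fun X => α.app X) (fun {X Y} f => by
    obtain ⟨X, rfl⟩ := obj_surjective X
    obtain ⟨Y, rfl⟩ := obj_surjective Y
    change F.map f ≫ α.hom.app Y = α.hom.app X ≫ G.map f
    refine hom_induction (p := fun f => F.map f ≫ α.hom.app Y = α.hom.app X ≫ G.map f) f
      ?_ (fun f g hf hg => ?_) (fun f n => ?_)
    · rw [F.map_zero, G.map_zero, zero_comp, comp_zero]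
    · simp only [F.map_add, G.map_add, add_comp, comp_add, hf, hg]
    · rw [F.map_zsmul, G.map_zsmul, zsmul_comp, comp_zsmul]
      exact congrArg (n • ·) (α.hom.naturality f))

end FreeExtension

/-! ### Additive extension of functors to matrices. -/

namespace MatExtension

lemma biproduct_matrix_add {A : Type u'} [Category.{w'} A] [Preadditive A]
    [HasFiniteBiproducts A] {J K : Type} [Finite J] [Finite K] {X : J → A} {Y : K → A}
    (f g : ∀ i j, X i ⟶ Y j) :
    biproduct.matrix (fun i j => f i j + g i j) = biproduct.matrix f + biproduct.matrix g := by
  ext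
  simp

variable {C : Type u} [Category.{w} C] [Preadditive C]
  {A : Type u'} [Category.{w'} A] [Preadditive A]

/-- The additive extension of an additive functor to the category of matrices. -/
noncomputable def lift [HasFiniteBiproducts A] (F : C ⥤ A) [F.Additive] : Mat_ C ⥤ A where
  obj X := ⨁ fun i => F.obj (X.X i)
  map f := biproduct.matrix fun i j => F.map (f i j)
  map_id X := by
    ext i j
    by_cases h : j = i
    · subst h; simp
    · simp [h]
  map_comp f g := by
    refine biproduct.hom_ext _ _ fun k => biproduct.hom_ext' _ _ fun i => ?_
    simp [biproduct.lift_desc]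

instance [HasFiniteBiproducts A] (F : C ⥤ A) [F.Additive] : (lift F).Additive where
  map_add {X Y f g} := by
    refine Eq.trans ?_ (biproduct_matrix_add (fun i j => F.map (f i j)) (fun i j => F.map (g i j)))
    exact congrArg biproduct.matrix (funext₂ fun i j => F.map_add)

/-- The extension to the category of matrices restricts to the given functor. -/
noncomputable def embeddingLiftIso [HasFiniteBiproducts A] (F : C ⥤ A) [F.Additive] :
    Mat_.embedding C ⋙ lift F ≅ F :=
  NatIso.ofComponents
    (fun X =>
      { hom := biproduct.π (fun _ : PUnit => F.obj X) PUnit.unit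
        inv := biproduct.ι (fun _ : PUnit => F.obj X) PUnit.unit
        hom_inv_id := biproduct.hom_ext' _ _ fun ⟨⟩ =>
          (biproduct.ι_π_self_assoc _ _ _).trans (Category.comp_id _).symm
        inv_hom_id := biproduct.ι_π_self _ _ })
    (fun _ => biproduct.matrix_π _ _ |>.trans (biproduct.hom_ext' _ _ fun ⟨⟩ =>
      (biproduct.ι_desc _ _).trans
        (biproduct.ι_π_self_assoc (fun _ : PUnit => F.obj _) _ _).symm))

/-- The projection of an object of the category of matrices to a summand. -/
noncomputable def proj (M : Mat_ C) (i : M.ι) : M ⟶ (Mat_.embedding C).obj (M.X i) :=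
  fun k _ => (𝟙 M : Mat_.Hom M M) k i

/-- The inclusion of a summand of an object of the category of matrices. -/
noncomputable def incl (M : Mat_ C) (i : M.ι) : (Mat_.embedding C).obj (M.X i) ⟶ M :=
  fun _ k => (𝟙 M : Mat_.Hom M M) i k

/-- Taking an entry of a matrix, as an additive map. -/
def entry (M N : Mat_ C) (k : M.ι) (l : N.ι) : (M ⟶ N) →+ (M.X k ⟶ N.X l) where
  toFun f := f k l
  map_zero' := rfl
  map_add' _ _ := rfl

lemma sum_proj_incl (M : Mat_ C) : ∑ i, proj M i ≫ incl M i = 𝟙 M := by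
  refine Mat_.hom_ext _ _ fun k l => ?_
  have h : ∀ i, entry M M k l (proj M i ≫ incl M i) =
      (𝟙 M : Mat_.Hom M M) k i ≫ (𝟙 M : Mat_.Hom M M) i l :=
    fun i => Fintype.sum_unique (ι := PUnit) fun _ =>
      (𝟙 M : Mat_.Hom M M) k i ≫ (𝟙 M : Mat_.Hom M M) i l
  have h' := congr_fun (congr_fun (Category.comp_id (𝟙 M)) k) l
  refine (map_sum (entry M M k l) _ _).trans ((Finset.sum_congr rfl fun i _ => h i).trans ?_)
  exact h'

lemma incl_comp_proj {M N : Mat_ C} (f : M ⟶ N) (i : M.ι) (j : N.ι) :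
    incl M i ≫ f ≫ proj N j = (Mat_.embedding C).map (f i j) := by
  refine Mat_.hom_ext _ _ fun _ _ => ?_
  have h : 𝟙 M ≫ f ≫ 𝟙 N = f := by simp
  exact congr_fun (congr_fun h i) j

section

variable {F G H : Mat_ C ⥤ A} [F.Additive]

/-- The comparison of two additive functors on the category of matrices which is determined by
a comparison of their restrictions. -/
noncomputable def extApp (α : Mat_.embedding C ⋙ F ⟶ Mat_.embedding C ⋙ G) (M : Mat_ C) :
    F.obj M ⟶ G.obj M :=
  ∑ i, F.map (proj M i) ≫ α.app (M.X i) ≫ G.map (incl M i)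

lemma extApp_naturality [G.Additive] (α : Mat_.embedding C ⋙ F ⟶ Mat_.embedding C ⋙ G)
    {M N : Mat_ C} (f : M ⟶ N) : F.map f ≫ extApp α N = extApp α M ≫ G.map f := by
  have h (i j) : F.map (incl M i) ≫ F.map f ≫ F.map (proj N j) ≫ α.app (N.X j) =
      α.app (M.X i) ≫ G.map (incl M i) ≫ G.map f ≫ G.map (proj N j) := by
    rw [← F.map_comp_assoc f, ← F.map_comp_assoc, ← G.map_comp, ← G.map_comp, incl_comp_proj]
    exact α.naturality (f i j)
  calc F.map f ≫ extApp α N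
      = F.map (∑ i, proj M i ≫ incl M i) ≫ F.map f ≫ extApp α N := by simp [sum_proj_incl]
    _ = ∑ j, ∑ i, F.map (proj M i) ≫ (F.map (incl M i) ≫ F.map f ≫ F.map (proj N j) ≫
          α.app (N.X j)) ≫ G.map (incl N j) := by
        simp only [extApp, Functor.map_sum, Functor.map_comp, sum_comp, comp_sum, Category.assoc]
    _ = extApp α M ≫ G.map f ≫ G.map (∑ j, proj N j ≫ incl N j) := by
        simp only [h, extApp, Functor.map_sum, Functor.map_comp, sum_comp, comp_sum,
          Category.assoc]
    _ = _ := by simp [sum_proj_incl]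

/-- Compatibility with projections makes `extApp` multiplicative, so that the inverse of a
comparison extends to an inverse. -/
lemma extApp_proj (α : Mat_.embedding C ⋙ F ⟶ Mat_.embedding C ⋙ G) (M : Mat_ C) (i : M.ι) :
    extApp α M ≫ G.map (proj M i) = F.map (proj M i) ≫ α.app (M.X i) := by
  have h (j) : α.app (M.X j) ≫ G.map (incl M j) ≫ G.map (proj M i) =
      F.map (incl M j) ≫ F.map (proj M i) ≫ α.app (M.X i) := by
    have := incl_comp_proj (𝟙 M) j i
    rw [Category.id_comp] at this
    rw [← F.map_comp_assoc, ← G.map_comp, this]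
    exact (α.naturality _).symm
  calc _ = F.map (∑ j, proj M j ≫ incl M j) ≫ F.map (proj M i) ≫ α.app (M.X i) := by
        simp only [extApp, Functor.map_sum, Functor.map_comp, sum_comp, h, Category.assoc]
    _ = _ := by simp [sum_proj_incl]

lemma extApp_comp (α : Mat_.embedding C ⋙ F ⟶ Mat_.embedding C ⋙ G)
    (β : Mat_.embedding C ⋙ G ⟶ Mat_.embedding C ⋙ H) (M : Mat_ C) :
    extApp α M ≫ extApp β M = extApp (α ≫ β) M := by
  simp only [extApp, comp_sum]
  refine Finset.sum_congr rfl fun i _ => ?_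
  have := extApp_proj α M i
  simp only [extApp] at this
  rw [← Category.assoc, this]
  simp

lemma extApp_id (M : Mat_ C) : extApp (𝟙 (Mat_.embedding C ⋙ F)) M = 𝟙 _ := by
  rw [← F.map_id, ← sum_proj_incl M]
  simp [extApp]

/-- Additive functors on the category of matrices are determined by their restriction. -/
noncomputable def ext [G.Additive] (α : Mat_.embedding C ⋙ F ≅ Mat_.embedding C ⋙ G) : F ≅ G :=
  NatIso.ofComponents
    (fun M =>
      { hom := extApp α.hom M
        inv := extApp α.inv M
        hom_inv_id := by rw [extApp_comp, α.hom_inv_id, extApp_id]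
        inv_hom_id := by rw [extApp_comp, α.inv_hom_id, extApp_id] })
    (fun f => extApp_naturality α.hom f)

end

end MatExtension

/-! ### The universal properties of `add(C)` and of `Ab(add(C))`. -/

namespace AddHull

variable {C : Type u} [Category.{w} C] {A : Type u'} [Category.{w'} A] [Preadditive A]

/-- The additive extension of a functor to the additive hull. -/
noncomputable def lift [HasFiniteBiproducts A] (G : C ⥤ A) : AddHull C ⥤ A :=
  MatExtension.lift (FreeExtension.lift G)

instance [HasFiniteBiproducts A] (G : C ⥤ A) : (lift G).Additive :=
  inferInstanceAs (MatExtension.lift (FreeExtension.lift G)).Additive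

/-- The extension to the additive hull restricts to the given functor. -/
noncomputable def embeddingLiftIso [HasFiniteBiproducts A] (G : C ⥤ A) :
    addHullEmbedding C ⋙ lift G ≅ G :=
  Functor.associator _ _ _ ≪≫
    Functor.isoWhiskerLeft _ (MatExtension.embeddingLiftIso (FreeExtension.lift G)) ≪≫
    FreeExtension.embeddingLiftIso G

/-- Additive functors on the additive hull are determined by their restriction. -/
noncomputable def ext {F G : AddHull C ⥤ A} [F.Additive] [G.Additive]
    (α : addHullEmbedding C ⋙ F ≅ addHullEmbedding C ⋙ G) : F ≅ G :=
  MatExtension.ext (FreeExtension.ext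
    ((Functor.associator _ _ _).symm ≪≫ α ≪≫ Functor.associator _ _ _))

/-- The canonical functors to the additive hulls are natural. -/
noncomputable def embeddingMapIso {D : Type u} [Category.{w} D] (F : C ⥤ D) :
    addHullEmbedding C ⋙ addHullMap F ≅ F ⋙ addHullEmbedding D :=
  NatIso.ofComponents (fun _ => Iso.refl _) (fun {X Y} f => by
    refine (Category.comp_id _).trans (Eq.trans ?_ (Category.id_comp _).symm)
    ext i j
    exact (Free.lift_map_single ℤ (F ⋙ Free.embedding ℤ D) f 1).trans (one_smul _ _))

instance : HasBinaryBiproducts (AddHull C) :=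
  hasBinaryBiproducts_of_finite_biproducts _

end AddHull

section AbAdd

attribute [local instance] Abelian.hasFiniteBiproducts

variable {C : Type u} [Category.{w} C]

/-- The canonical functors to the abelian hulls of the additive hulls are natural. -/
noncomputable def toAbAddMapIso {D : Type u} [Category.{w} D] (F : C ⥤ D) :
    toAbAdd C ⋙ abAddMap F ≅ F ⋙ toAbAdd D :=
  Functor.associator _ _ _ ≪≫
    Functor.isoWhiskerLeft _ (AbHull.embeddingMapIso (addHullMap F)) ≪≫
    (Functor.associator _ _ _).symm ≪≫
    Functor.isoWhiskerRight (AddHull.embeddingMapIso F) _ ≪≫ Functor.associator _ _ _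

variable {A : Type u'} [Category.{w'} A] [Abelian A]

/-- The exact extension of a functor to the abelian hull of the additive hull. -/
noncomputable def abAddLift (G : C ⥤ A) : AbHull (AddHull C) ⥤ A :=
  AbHull.lift (AddHull.lift G)

instance (G : C ⥤ A) : PreservesFiniteLimits (abAddLift G) :=
  inferInstanceAs (PreservesFiniteLimits (AbHull.lift (AddHull.lift G)))

instance (G : C ⥤ A) : PreservesFiniteColimits (abAddLift G) :=
  inferInstanceAs (PreservesFiniteColimits (AbHull.lift (AddHull.lift G)))

/-- The exact extension of a functor restricts to that functor. -/
noncomputable def toAbAddLiftIso (G : C ⥤ A) : toAbAdd C ⋙ abAddLift G ≅ G :=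
  Functor.associator _ _ _ ≪≫
    Functor.isoWhiskerLeft _ (AbHull.embeddingLiftIso (AddHull.lift G)) ≪≫
    AddHull.embeddingLiftIso G

/-- Exact functors on the abelian hull of the additive hull are determined by their restriction. -/
lemma nonempty_iso_of_toAbAdd_comp_iso {F G : AbHull (AddHull C) ⥤ A}
    [PreservesFiniteLimits F] [PreservesFiniteLimits G]
    [PreservesFiniteColimits F] [PreservesFiniteColimits G]
    (α : toAbAdd C ⋙ F ≅ toAbAdd C ⋙ G) : Nonempty (F ≅ G) :=
  have := F.additive_of_preserves_binary_products
  have := G.additive_of_preserves_binary_products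
  AbHull.nonempty_iso_of_embedding_comp_iso (AddHull.ext
    ((Functor.associator _ _ _).symm ≪≫ α ≪≫ Functor.associator _ _ _))

end AbAdd

/-! ### Serre quotients of the hull versus the hull of the localisation. -/

section Localization

variable {C : Type u} [Category.{w} C] {A : Type u'} [Category.{w'} A] [Abelian A]

lemma isInvertedBy_of_kernelsCokernels_le (F : C ⥤ A) (W : MorphismProperty C)
    (S : ObjectProperty A) [S.IsSerreClass] (h : KernelsCokernels F W ≤ S) :
    W.IsInvertedBy (F ⋙ S.isoModSerre.Q) := fun _ _ f hf =>
  S.isoModSerre.Q_inverts (F.map f) ⟨h _ (.kernel f hf), h _ (.cokernel f hf)⟩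

/-- The kernel of an exact functor is a Serre class, and it contains the kernel and cokernel of
every morphism that the functor inverts. -/
lemma serreGenerated_le_kernel {B : Type*} [Category* B] [Abelian B] (F : C ⥤ A)
    (W : MorphismProperty C) (G : A ⥤ B) [PreservesFiniteLimits G] [PreservesFiniteColimits G]
    (h : W.IsInvertedBy (F ⋙ G)) : serreGenerated (KernelsCokernels F W) ≤ G.kernel := by
  intro X hX
  refine hX _ inferInstance ?_
  rintro _ (⟨f, hf⟩ | ⟨f, hf⟩)
  · have : IsIso (G.map (F.map f)) := h f hf
    exact (isZero_kernel_of_mono (G.map (F.map f))).of_iso (PreservesKernel.iso G (F.map f))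
  · have : IsIso (G.map (F.map f)) := h f hf
    exact (isZero_cokernel_of_epi (G.map (F.map f))).of_iso (PreservesCokernel.iso G (F.map f))

end Localization

/-- Localising the abelian hull at the Serre subcategory generated by the kernels and cokernels of
a class of morphisms gives the abelian hull of the localisation. -/
theorem exists_serreQuotient_equivalence {C : Type v} [Category.{v} C] (W : MorphismProperty C) :
    ∃ e : (serreGenerated (KernelsCokernels (toAbAdd C) W)).isoModSerre.Localization ≌
        AbHull (AddHull W.Localization),
      Nonempty ((serreGenerated (KernelsCokernels (toAbAdd C) W)).isoModSerre.Q ⋙ e.functor ≅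
        abAddMap W.Q) := by
  let S := serreGenerated (KernelsCokernels (toAbAdd C) W)
  let Q := S.isoModSerre.Q
  let _ : Abelian S.isoModSerre.Localization :=
    ObjectProperty.SerreClassLocalization.abelian S.isoModSerre.Q S
  have : PreservesFiniteLimits Q :=
    ObjectProperty.SerreClassLocalization.preservesFiniteLimits Q S
  have : PreservesFiniteColimits Q :=
    ObjectProperty.SerreClassLocalization.preservesFiniteColimits Q S
  let q := abAddMap W.Q
  have hq : S.isoModSerre.IsInvertedBy q := by
    rw [ObjectProperty.isoModSerre_isInvertedBy_iff]
    refine serreGenerated_le_kernel _ _ _ ?_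
    rw [MorphismProperty.IsInvertedBy.iff_of_iso _ (toAbAddMapIso W.Q)]
    exact MorphismProperty.IsInvertedBy.of_comp _ _ W.Q_inverts _
  -- `E` comes from the universal property of the Serre quotient. Its inverse `H` comes from those
  -- of the localisation and of the hull: `G` extends `toAbAdd C ⋙ Q`, which inverts `W`, and `H`
  -- extends `G` exactly.
  let E := Localization.lift q hq Q
  let ε : Q ⋙ E ≅ q := Localization.fac q hq Q
  have hW : W.IsInvertedBy (toAbAdd C ⋙ Q) :=
    isInvertedBy_of_kernelsCokernels_le _ _ S fun X hX _ _ h => h X hX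
  let G := Localization.lift (toAbAdd C ⋙ Q) hW W.Q
  let γ : W.Q ⋙ G ≅ toAbAdd C ⋙ Q := Localization.fac _ hW W.Q
  let H := abAddLift G
  let η : toAbAdd W.Localization ⋙ H ≅ G := toAbAddLiftIso G
  -- Exactness of a functor on the Serre quotient can be tested after composing with `Q`, where it
  -- is the exactness of `q`.
  have hE : PreservesFiniteLimits E := by
    rw [← ObjectProperty.SerreClassLocalization.preservesFiniteLimits_comp_iff Q S]
    exact preservesFiniteLimits_of_natIso ε.symm
  have hE' : PreservesFiniteColimits E := by
    rw [← ObjectProperty.SerreClassLocalization.preservesFiniteColimits_comp_iff Q S]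
    exact preservesFiniteColimits_of_natIso ε.symm
  have : PreservesFiniteLimits (q ⋙ H) := comp_preservesFiniteLimits _ _
  have : PreservesFiniteColimits (q ⋙ H) := comp_preservesFiniteColimits _ _
  have : PreservesFiniteLimits (H ⋙ E) := comp_preservesFiniteLimits _ _
  have : PreservesFiniteColimits (H ⋙ E) := comp_preservesFiniteColimits _ _
  -- Both sides are exact on `Ab(add(C))`, so agreement on `C` is enough. For `ι` the same principle
  -- is used on the hull of the localisation.
  obtain ⟨θ⟩ : Nonempty (q ⋙ H ≅ Q) := nonempty_iso_of_toAbAdd_comp_iso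
    ((Functor.associator _ _ _).symm ≪≫ Functor.isoWhiskerRight (toAbAddMapIso W.Q) H ≪≫
      Functor.associator _ _ _ ≪≫ Functor.isoWhiskerLeft W.Q η ≪≫ γ)
  let κ : G ⋙ E ≅ toAbAdd W.Localization :=
    Localization.liftNatIso W.Q W (W.Q ⋙ G ⋙ E) (W.Q ⋙ toAbAdd W.Localization) _ _
      ((Functor.associator _ _ _).symm ≪≫ Functor.isoWhiskerRight γ E ≪≫
        Functor.associator _ _ _ ≪≫ Functor.isoWhiskerLeft _ ε ≪≫ toAbAddMapIso W.Q)
  obtain ⟨ι⟩ : Nonempty (H ⋙ E ≅ 𝟭 _) := nonempty_iso_of_toAbAdd_comp_iso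
    ((Functor.associator _ _ _).symm ≪≫ Functor.isoWhiskerRight η E ≪≫ κ ≪≫
      (Functor.rightUnitor _).symm)
  let ρ : E ⋙ H ≅ 𝟭 _ :=
    Localization.liftNatIso Q S.isoModSerre (Q ⋙ E ⋙ H) (Q ⋙ 𝟭 _) _ _
      ((Functor.associator _ _ _).symm ≪≫ Functor.isoWhiskerRight ε H ≪≫ θ ≪≫
        (Functor.rightUnitor _).symm)
  exact ⟨CategoryTheory.Equivalence.mk E H ρ.symm ι, ⟨ε⟩⟩

/-! ### Transfer of largeness along faithful functors, and of countability through the hulls. -/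

section Faithful

instance (C : Type u) [Category.{w} C] : (Free.embedding ℤ C).Faithful where
  map_injective h := Finsupp.single_left_injective (M := ℤ) one_ne_zero h

lemma not_locallySmall_of_faithful {C D : Type*} [Category* C] [Category* D] (F : C ⥤ D)
    [F.Faithful] (h : ¬ LocallySmall.{u} C) : ¬ LocallySmall.{u} D :=
  fun _ => h ⟨fun _ _ => small_of_injective F.map_injective⟩

end Faithful

section Countable

lemma RightFreyd.countable_hom {V : Type*} [Category* V] [Preadditive V]
    [∀ X Y : V, Countable (X ⟶ Y)] (X Y : RightFreyd V) : Countable (X ⟶ Y) := by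
  obtain ⟨u, rfl⟩ := RightFreyd.obj_surjective X
  obtain ⟨v, rfl⟩ := RightFreyd.obj_surjective Y
  have : Countable (u ⟶ v) :=
    Function.Injective.countable (f := fun f : u ⟶ v => (f.left, f.right)) fun f g h =>
      Arrow.hom_ext _ _ (congrArg Prod.fst h) (congrArg Prod.snd h)
  exact ((RightFreyd.quotient V).map_surjective (X := u) (Y := v)).countable

lemma countable_op_hom {V : Type*} [Category* V] (h : ∀ X Y : V, Countable (X ⟶ Y))
    (X Y : Vᵒᵖ) : Countable (X ⟶ Y) :=
  have := h Y.unop X.unop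
  (opEquiv X Y).injective.countable

lemma AddHull.countable_hom {C : Type u} [Category.{w} C] (h : ∀ X Y : C, Countable (X ⟶ Y))
    (X Y : AddHull C) : Countable (X ⟶ Y) := by
  have (X Y : Free ℤ C) : Countable (X ⟶ Y) := by
    obtain ⟨X, rfl⟩ := FreeExtension.obj_surjective X
    obtain ⟨Y, rfl⟩ := FreeExtension.obj_surjective Y
    have := h X Y
    exact inferInstanceAs (Countable ((X ⟶ Y) →₀ ℤ))
  exact inferInstanceAs (Countable (∀ (i : X.ι) (j : Y.ι), X.X i ⟶ Y.X j))

lemma AbHull.countable_hom {C : Type u} [Category.{w} C] [Preadditive C]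
    (h : ∀ X Y : C, Countable (X ⟶ Y)) (X Y : AbHull C) : Countable (X ⟶ Y) :=
  have := countable_op_hom (V := RightFreyd C) RightFreyd.countable_hom
  countable_op_hom RightFreyd.countable_hom X Y

end Countable

/-! ### The path category of the quiver and the morphisms of its localisation. -/

namespace SpanPaths

variable {I : Type v}

/-- Arrows start at some `y i` and end at `x` or `z`. No arrow ends at `y i`, so no path returns
there. -/
lemma not_path_of_arrow {a c : SpanVertex I} (p : Quiver.Path a c) (e : SpanArrow I c a) :
    False := by
  cases e with
  | σ i => cases p with
    | cons _ e => change SpanArrow I _ _ at e; cases e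
  | τ i => cases p with
    | cons _ e => change SpanArrow I _ _ at e; cases e

/-- Paths have length at most one and there is at most one arrow between two vertices, so the path
category is thin. -/
lemma path_eq {a b : SpanVertex I} (p q : Quiver.Path a b) : p = q := by
  cases p with
  | nil => cases q with
    | nil => rfl
    | cons q e => exact (not_path_of_arrow q e).elim
  | cons p e => cases q with
    | nil => exact (not_path_of_arrow p e).elim
    | cons q e' =>
      change SpanArrow I _ _ at e e'
      cases e <;> cases e' <;> cases p with
      | cons _ e => change SpanArrow I _ _ at e; cases e
      | nil => cases q with
        | nil => rfl
        | cons _ e => change SpanArrow I _ _ at e; cases e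

lemma countable_hom (X Y : Paths (SpanVertex I)) : Countable (X ⟶ Y) :=
  have : Subsingleton (X ⟶ Y) := ⟨path_eq (a := (X : SpanVertex I)) (b := (Y : SpanVertex I))⟩
  inferInstance

/-- The morphism `σ i` inverted in the localisation. -/
abbrev σInv (i : I) : (Sig I).Q.obj (x I) ⟶ (Sig I).Q.obj (y i) :=
  Localization.Construction.wInv (σ i) (MorphismProperty.ofHoms.mk i)

lemma σInv_comp (i : I) : σInv i ≫ (Sig I).Q.map (σ i) = 𝟙 _ :=
  (Localization.Construction.wIso (σ i) (MorphismProperty.ofHoms.mk i)).inv_hom_id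

/-- The morphisms out of `x` of the localisation in normal form. -/
def IsNormal : ∀ b : SpanVertex I,
    ((Sig I).Q.obj (x I) ⟶ (Sig I).Q.obj ((Paths.of (SpanVertex I)).obj b)) → Prop
  | .x, g => g = 𝟙 _
  | .y i, g => g = σInv i
  | .z, g => ∃ i : I, g = σInv i ≫ (Sig I).Q.map (τ i)

variable (I) in
/-- The morphisms of the localisation preserving normal forms. -/
def preservesNormal : MorphismProperty (Sig I).Localization := fun X Y f =>
  ∀ g : (Sig I).Q.obj (x I) ⟶ X, IsNormal X.as.obj g → IsNormal Y.as.obj (g ≫ f)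

instance : (preservesNormal I).IsStableUnderComposition where
  comp_mem f g hf hg k hk :=
    (congrArg (IsNormal _) (Category.assoc k f g)).mp (hg _ (hf _ hk))

lemma preservesNormal_map {a b : SpanVertex I} (e : a ⟶ b) :
    preservesNormal I ((Sig I).Q.map ((Paths.of _).map e)) := by
  intro g hg
  change SpanArrow I _ _ at e
  cases e with
  | σ i =>
    obtain rfl : g = σInv i := hg
    exact σInv_comp i
  | τ i =>
    obtain rfl : g = σInv i := hg
    exact ⟨i, rfl⟩

/-- Morphisms of the localisation are generated by images of paths and by the formal inverses, so
stability of normal forms need only be checked on these. -/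
lemma preservesNormal_eq_top : preservesNormal I = ⊤ := by
  refine Localization.Construction.morphismProperty_eq_top _ (fun X Y f => ?_) ?_
  · change Quiver.Path (V := SpanVertex I) X Y at f
    induction f with
    | nil =>
      intro g hg
      have : g ≫ (Sig I).Q.map (𝟙 X) = g := by
        rw [CategoryTheory.Functor.map_id, Category.comp_id]
      exact this.symm ▸ hg
    | cons p e hp =>
      have := (preservesNormal I).comp_mem _ _ hp (preservesNormal_map e)
      exact ((Sig I).Q.map_comp p ((Paths.of (SpanVertex I)).map e)).symm ▸ this
  -- The source of the inverse of `σ i` is `x`, where the identity is the only normal form.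
  · rintro _ _ _ ⟨i⟩ g hg
    obtain rfl : g = 𝟙 _ := hg
    exact Category.id_comp _

lemma surjective_σInv_comp_τ (f : (Sig I).Q.obj (x I) ⟶ (Sig I).Q.obj (z I)) :
    ∃ i : I, σInv i ≫ (Sig I).Q.map (τ i) = f := by
  have hf : preservesNormal I f := preservesNormal_eq_top (I := I) ▸ MorphismProperty.top_apply f
  -- The identity of `x` is normal, hence so is its composite with `f`.
  obtain ⟨i, hi⟩ := hf (𝟙 _) rfl
  exact ⟨i, hi.symm.trans (Category.id_comp f)⟩

variable (I) in
/-- The functor to the free group on `I` sending `σ i` to `1` and `τ i` to the generator `i`. -/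
def toFreeGroup : Paths (SpanVertex I) ⥤ SingleObj (FreeGroup I) :=
  Paths.lift
    { obj := fun _ => SingleObj.star _
      map := fun e => match e with
        | .σ _ => (1 : FreeGroup I)
        | .τ i => FreeGroup.of i }

variable (I) in
/-- The extension of the functor to the free group to the localisation. -/
noncomputable def localizationToFreeGroup : (Sig I).Localization ⥤ SingleObj (FreeGroup I) :=
  Localization.Construction.lift (toFreeGroup I) fun _ _ _ _ => inferInstance

lemma localizationToFreeGroup_map_Q {a b : SpanVertex I} (e : a ⟶ b) :
    (localizationToFreeGroup I).map ((Sig I).Q.map ((Paths.of (SpanVertex I)).map e)) =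
      (toFreeGroup I).map ((Paths.of (SpanVertex I)).map e) :=
  Category.id_comp _

lemma localizationToFreeGroup_map (i : I) :
    (localizationToFreeGroup I).map (σInv i ≫ (Sig I).Q.map (τ i)) = FreeGroup.of i := by
  have hσ : (toFreeGroup I).map (σ i) = 𝟙 _ := Category.id_comp _
  have hτ : (toFreeGroup I).map (τ i) = FreeGroup.of i := Category.id_comp _
  have h := congrArg (localizationToFreeGroup I).map (σInv_comp i)
  rw [CategoryTheory.Functor.map_comp, CategoryTheory.Functor.map_id,
    localizationToFreeGroup_map_Q, hσ] at h
  -- Since `σ i` goes to `1`, so does its inverse, and only the generator from `τ i` remains.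
  have h₁ := (Category.comp_id _).symm.trans h
  rw [CategoryTheory.Functor.map_comp, localizationToFreeGroup_map_Q, h₁, hτ]
  exact Category.id_comp _

lemma bijective_σInv_comp_τ :
    Function.Bijective fun i : I => σInv i ≫ (Sig I).Q.map (τ i) :=
  ⟨fun i j h => FreeGroup.of_injective (by
    rw [← localizationToFreeGroup_map, ← localizationToFreeGroup_map]
    exact congrArg _ h), surjective_σInv_comp_τ⟩

lemma not_locallySmall_localization (hI : ¬ Small.{u} I) :
    ¬ LocallySmall.{u} (Sig I).Localization := fun _ =>
  hI (small_of_injective (bijective_σInv_comp_τ (I := I)).injective)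

end SpanPaths

theorem mainTheorem4 (I : Type v) (hI : ¬ Small.{u} I) :
    ∃ _ : Abelian (AbHull (AddHull (Paths (SpanVertex I)))),
      let S := serreGenerated
        (KernelsCokernels (toAbAdd (Paths (SpanVertex I))) (SpanPaths.Sig I))
      LocallySmall.{u} (AbHull (AddHull (Paths (SpanVertex I)))) ∧
      (∃ e : S.isoModSerre.Localization ≌ AbHull (AddHull (SpanPaths.Sig I).Localization),
        Nonempty (S.isoModSerre.Q ⋙ e.functor ≅ abAddMap (SpanPaths.Sig I).Q)) ∧
      Function.Bijective (fun i : I =>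
        ((Localization.Construction.wInv (SpanPaths.σ i) (MorphismProperty.ofHoms.mk i) ≫
          (SpanPaths.Sig I).Q.map (SpanPaths.τ i) :
            (SpanPaths.Sig I).Q.obj (SpanPaths.x I) ⟶ (SpanPaths.Sig I).Q.obj (SpanPaths.z I)))) ∧
      ¬ LocallySmall.{u} (SpanPaths.Sig I).Localization ∧
      ¬ LocallySmall.{u} (AbHull (AddHull (SpanPaths.Sig I).Localization)) ∧
      ¬ LocallySmall.{u} S.isoModSerre.Localization := by
  have hL := SpanPaths.not_locallySmall_localization hI
  have hAb : ¬ LocallySmall.{u} (AbHull (AddHull (SpanPaths.Sig I).Localization)) :=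
    -- Each of the embeddings composing `toAbAdd` is faithful, so the large hom set survives in the
    -- hull.
    not_locallySmall_of_faithful (toAbAdd _) hL
  obtain ⟨e, he⟩ := exists_serreQuotient_equivalence (SpanPaths.Sig I)
  refine ⟨inferInstance, ⟨fun X Y => ?_⟩, ⟨e, he⟩, SpanPaths.bijective_σInv_comp_τ, hL, hAb,
    not_locallySmall_of_faithful e.inverse hAb⟩
  -- Countable hom sets are small in every universe, however large `I` is.
  have := AbHull.countable_hom
    (AddHull.countable_hom.{v, v} (SpanPaths.countable_hom (I := I))) X Y
  infer_instance
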